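/- Let $r\ge 5$ be odd, and let $e_1,\dots,e_r$ be the standard orthonormal basis of $\mathbb R^r$. Let $W(D_r)$ be the group of signed permutations of $e_1,\dots,e_r$ with an even number of sign changes, let $\Pi_+=\{e_i-e_j,\ e_i+e_j : 1\le i<j\le r\}$ be the positive roots, and let $\alpha_i=e_i-e_{i+1}$ $(1\le i\le r-1)$ and $\alpha_r=e_{r-1}+e_r$ be the simple roots, with reflections $s_1,\dots,s_r$. Write $\rho\le\eta$ if $\eta-\rho\in\sum_{a=1}^r\mathbb Z_{\ge 0}\alpha_a$, and for $S\subseteq\Pi_+$ put $\operatorname{Adj}(S)=\{\gamma\in\Pi_+ : \gamma\le\beta\text{ for some }\beta\in S\}$. For $u\in W(D_r)$ put $\nu_0(u)=u(\Pi_+)\cap\Pi_+$ and $\nu_k(u)=u(\operatorname{Adj}(\nu_{k-1}(u)))\cap\Pi_+$ for $k\ge 1$; the element $u$ is called rational if $\nu_k(u)=\varnothing$ for all sufficiently large $k$. Let $\Gamma(D_r)$ be the graph whose vertices are the rational elements of $W(D_r)$, two of them being adjacent if one is obtained from the other by left multiplication by some $s_a$, $1\le a\le r$. Let $w_0$ be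 the longest element of $W(D_r)$, given by $w_0(e_i)=-e_i$ for $1\le i\le r-1$ and $w_0(e_r)=e_r$. For a non-empty $I=\{i_1<\cdots<i_k\}\subseteq\{1,\dots,r-1\}$ let $p_I$ be the cycle $i_1\mapsto i_2\mapsto\cdots\mapsto i_k\mapsto r\mapsto i_1$ in $S_r$, and define signed permutations $c_I$ and $d_I$ by $$c_I(e_j)=-e_{p_I(j)}\ (1\le j\le r-1),\qquad c_I(e_r)=e_{i_1},$$ $$d_I(e_j)=-e_{p_I(j)}\ (1\le j\le r-1,\ j\ne i_k),\qquad d_I(e_{i_k})=e_r,\qquad d_I(e_r)=-e_{i_1}.$$ Let $\tau$ be the diagram automorphism with $\tau(e_j)=e_j$ for $1\le j\le r-1$ and $\tau(e_r)=-e_r$. Then $w_0$ and all $c_I$, $d_I$ are vertices of $\Gamma(D_r)$, and $\Gamma(D_r)$ is the union (of vertex sets and of edge sets) of its two induced subgraphs $$\Gamma_c=\Gamma(D_r)\bigl[\{w_0\}\cup\{c_I : I\ne\varnothing\}\bigr],\qquad \Gamma_d=\Gamma(D_r)\bigl[\{w_0\}\cup\{d_I : I\ne\varnothing\}\bigr].$$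 The vertex sets of $\Gamma_c$ and $\Gamma_d$ intersect exactly in $\{w_0\}$, and $u\mapsto\tau u\tau^{-1}$ defines a graph isomorphism $\Gamma_c\to\Gamma_d$. -/

import Mathlib

/-!
The root system of type `D_r`, `r = n + 1`, in the signed-permutation model.
Coordinates are indexed by `Fin (n + 1)`: the usual label `j` in `{1, …, r}` is the index `j - 1`.
In particular `r` is `Fin.last n`, and `{1, …, r - 1}` is `Fin n`, embedded by `Fin.castSucc`.
-/

namespace TypeD

/-- The space `ℝ^r`, with the inner product `x ⬝ᵥ y`. -/
abbrev V (n : ℕ) : Type := Fin (n + 1) → ℝ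

/-- The standard (orthonormal) basis vector `e_j`. -/
def e {n : ℕ} (j : Fin (n + 1)) : V n := Pi.single j 1

/-- The positive roots `e_i - e_j` and `e_i + e_j`, for `i < j`. -/
def posRoots (n : ℕ) : Set (V n) :=
  {x | ∃ i j : Fin (n + 1), i < j ∧ x = e i - e j} ∪
    {x | ∃ i j : Fin (n + 1), i < j ∧ x = e i + e j}

/-- The simple roots: `e_i - e_{i+1}` for `1 ≤ i ≤ r - 1`, and `e_{r-1} + e_r`. -/
def simpleRoots (n : ℕ) : Set (V n) :=
  {x | ∃ i : Fin n, x = e i.castSucc - e i.succ} ∪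
    {x | ∃ i : Fin n, i.succ = Fin.last n ∧ x = e i.castSucc + e i.succ}

/-- The root order: `ρ ≤ η` iff `η - ρ` is a sum of simple roots with coefficients in `ℤ_{≥ 0}`. -/
def RootLE {n : ℕ} (ρ η : V n) : Prop := η - ρ ∈ AddSubmonoid.closure (simpleRoots n)

/-- `Adj(S)`: the positive roots that lie below some element of `S`. -/
def lowerRoots {n : ℕ} (S : Set (V n)) : Set (V n) :=
  {γ | γ ∈ posRoots n ∧ ∃ β ∈ S, RootLE γ β}

/-- The signed permutation with `e_j ↦ ε_j e_{π(j)}`. -/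
def signedPerm {n : ℕ} (π : Equiv.Perm (Fin (n + 1))) (ε : Fin (n + 1) → ℤˣ) :
    V n ≃ₗ[ℝ] V n where
  toFun x i := ((ε (π.symm i) : ℤ) : ℝ) * x (π.symm i)
  invFun x j := ((ε j : ℤ) : ℝ) * x (π j)
  map_add' x y := by ext i; simp [mul_add]
  map_smul' c x := by ext i; simp; ring
  left_inv x := by
    ext j
    rcases Int.units_eq_one_or (ε j) with h | h <;> simp [h]
  right_inv x := by
    ext i
    rcases Int.units_eq_one_or (ε (π.symm i)) with h | h <;> simp [h]

theorem signedPerm_e {n : ℕ} (π : Equiv.Perm (Fin (n + 1))) (ε : Fin (n + 1) → ℤˣ)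
    (j : Fin (n + 1)) : signedPerm π ε (e j) = ((ε j : ℤ) : ℝ) • e (π j) := by
  ext i
  by_cases h : i = π j
  · subst h; simp [signedPerm, e]
  · have h' : π.symm i ≠ j := fun h' => h (by rw [← h', Equiv.apply_symm_apply])
    simp [signedPerm, e, h, h']

theorem signedPerm_mul {n : ℕ} (π π' : Equiv.Perm (Fin (n + 1))) (ε ε' : Fin (n + 1) → ℤˣ) :
    signedPerm π ε * signedPerm π' ε' = signedPerm (π * π') (fun j => ε (π' j) * ε' j) := by
  ext x i
  simp [signedPerm, Equiv.Perm.mul_def, mul_assoc]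

theorem signedPerm_one (n : ℕ) :
    signedPerm (1 : Equiv.Perm (Fin (n + 1))) (fun _ => 1) = 1 := by
  ext1 x
  funext i
  change (((1 : ℤˣ) : ℤ) : ℝ) * x i = x i
  simp

/-- The Weyl group `W(D_r)`: the signed permutations of `e_1, …, e_r` with an even number of sign
changes, that is, with product of the signs equal to `1`. -/
def weylD (n : ℕ) : Subgroup (V n ≃ₗ[ℝ] V n) where
  carrier := {u | ∃ (π : Equiv.Perm (Fin (n + 1))) (ε : Fin (n + 1) → ℤˣ),
    ∏ j, ε j = 1 ∧ u = signedPerm π ε}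
  one_mem' := ⟨1, fun _ => 1, by simp, (signedPerm_one n).symm⟩
  mul_mem' := by
    rintro _ _ ⟨π, ε, hε, rfl⟩ ⟨π', ε', hε', rfl⟩
    refine ⟨π * π', fun j => ε (π' j) * ε' j, ?_, signedPerm_mul π π' ε ε'⟩
    rw [Finset.prod_mul_distrib, Equiv.prod_comp π' ε, hε, hε', one_mul]
  inv_mem' := by
    rintro _ ⟨π, ε, hε, rfl⟩
    refine ⟨π⁻¹, fun j => ε (π⁻¹ j), ?_, ?_⟩
    · rw [Equiv.prod_comp π⁻¹ ε, hε]
    · rw [inv_eq_iff_mul_eq_one, signedPerm_mul]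
      simp only [mul_inv_cancel, Int.units_mul_self]
      exact signedPerm_one n

/-- The orthogonal reflection `x ↦ x - 2 (x, α) / (α, α) α`. -/
noncomputable def reflection {n : ℕ} (α : V n) : V n ≃ₗ[ℝ] V n :=
  LinearEquiv.ofInvolutive
    { toFun := fun x => x - (2 * (x ⬝ᵥ α) / (α ⬝ᵥ α)) • α
      map_add' := fun x y => by
        rw [add_dotProduct, mul_add, add_div, add_smul]; abel
      map_smul' := fun c x => by
        rw [smul_dotProduct, RingHom.id_apply, smul_sub, smul_smul, smul_eq_mul]
        congr 2; ring }
    (fun x => by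
      by_cases h : α ⬝ᵥ α = 0
      · simp [h]
      · simp only [LinearMap.coe_mk, AddHom.coe_mk, sub_dotProduct, smul_dotProduct, smul_eq_mul]
        rw [sub_sub, ← add_smul]
        have : 2 * (x ⬝ᵥ α) / (α ⬝ᵥ α) +
            2 * (x ⬝ᵥ α - 2 * (x ⬝ᵥ α) / (α ⬝ᵥ α) * (α ⬝ᵥ α)) / (α ⬝ᵥ α) = 0 := by
          field_simp; ring
        rw [this, zero_smul, sub_zero])

theorem reflection_apply {n : ℕ} (α x : V n) :
    reflection α x = x - (2 * (x ⬝ᵥ α) / (α ⬝ᵥ α)) • α := rfl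

theorem reflection_mul_self {n : ℕ} (α : V n) : reflection α * reflection α = 1 := by
  ext1 x
  exact (reflection α).left_inv x

theorem simpleRoots_ne_zero {n : ℕ} {α : V n} (h : α ∈ simpleRoots n) : α ≠ 0 := by
  have key : ∀ i : Fin n, i.castSucc ≠ i.succ := fun i => (Fin.castSucc_lt_succ).ne
  rintro rfl
  rcases h with ⟨i, hi⟩ | ⟨i, -, hi⟩ <;>
  · have := congrFun hi i.castSucc
    simp [e, key i] at this

/-- The sequence `ν_0(u) = u(Π₊) ∩ Π₊`, `ν_k(u) = u(Adj(ν_{k-1}(u))) ∩ Π₊`. -/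
def nu {n : ℕ} (u : V n ≃ₗ[ℝ] V n) : ℕ → Set (V n)
  | 0 => u '' posRoots n ∩ posRoots n
  | k + 1 => u '' lowerRoots (nu u k) ∩ posRoots n

/-- `u` is rational if `ν_k(u) = ∅` for all sufficiently large `k`. -/
def IsRational {n : ℕ} (u : V n ≃ₗ[ℝ] V n) : Prop := ∃ K : ℕ, ∀ k ≥ K, nu u k = ∅

/-- The graph on all linear automorphisms of `ℝ^r` whose edges are the left multiplications by
simple reflections. -/
def leftMulGraph (n : ℕ) : SimpleGraph (V n ≃ₗ[ℝ] V n) where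
  Adj u v := ∃ α ∈ simpleRoots n, v = reflection α * u
  symm := ⟨by
    rintro u _ ⟨α, hα, rfl⟩
    exact ⟨α, hα, by rw [← mul_assoc, reflection_mul_self, one_mul]⟩⟩
  loopless := ⟨by
    rintro u ⟨α, hα, h⟩
    have h1 : reflection α = 1 := by simpa using h.symm
    have h2 : α ⬝ᵥ α ≠ 0 := fun h0 => simpleRoots_ne_zero hα (dotProduct_self_eq_zero.1 h0)
    have h3 : reflection α α = α := by rw [h1]; rfl
    rw [reflection_apply, mul_div_assoc, div_self h2, sub_eq_self] at h3
    simp [simpleRoots_ne_zero hα] at h3⟩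

/-- The rationality graph `Γ(D_r)`: its vertices are the rational elements of `W(D_r)`, and two of
them are adjacent if they differ by left multiplication by a simple reflection. -/
def rationalityGraph (n : ℕ) : (leftMulGraph n).Subgraph :=
  (⊤ : (leftMulGraph n).Subgraph).induce {u | u ∈ weylD n ∧ IsRational u}

/-- The longest element for `r` odd: `e_i ↦ -e_i` for `i < r`, and `e_r ↦ e_r`. -/
def w0 (n : ℕ) : V n ≃ₗ[ℝ] V n :=
  signedPerm 1 (fun j => if j = Fin.last n then 1 else -1)

/-- The cycle `p_I = (i_1 i_2 ⋯ i_k r)` for `I = {i_1 < ⋯ < i_k}`, a subset of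
`{1, …, r - 1}`. -/
def pCycle {n : ℕ} (I : Finset (Fin n)) : Equiv.Perm (Fin (n + 1)) :=
  (I.sort.map Fin.castSucc ++ [Fin.last n]).formPerm

/-- `c_I`: `e_j ↦ -e_{p_I(j)}` for `j < r`, and `e_r ↦ e_{p_I(r)} = e_{i_1}`. -/
def cElt {n : ℕ} (I : Finset (Fin n)) : V n ≃ₗ[ℝ] V n :=
  signedPerm (pCycle I) (fun j => if j = Fin.last n then 1 else -1)

/-- `d_I`: `e_{i_k} ↦ e_{p_I(i_k)} = e_r` for `i_k = max I`, and `e_j ↦ -e_{p_I(j)}` for all other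
`j`; in particular `e_r ↦ -e_{i_1}`. -/
def dElt {n : ℕ} (I : Finset (Fin n)) (hI : I.Nonempty) : V n ≃ₗ[ℝ] V n :=
  signedPerm (pCycle I) (fun j => if j = (I.max' hI).castSucc then 1 else -1)

/-- The set `{w_0} ∪ {c_I : I ≠ ∅}`. -/
def cSet (n : ℕ) : Set (V n ≃ₗ[ℝ] V n) :=
  {w0 n} ∪ {u | ∃ I : Finset (Fin n), I.Nonempty ∧ u = cElt I}

/-- The set `{w_0} ∪ {d_I : I ≠ ∅}`. -/
def dSet (n : ℕ) : Set (V n ≃ₗ[ℝ] V n) :=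
  {w0 n} ∪ {u | ∃ (I : Finset (Fin n)) (hI : I.Nonempty), u = dElt I hI}

/-- The induced subgraph `Γ_c` of `Γ(D_r)` on `{w_0} ∪ {c_I : I ≠ ∅}`. -/
def cHalf (n : ℕ) : (leftMulGraph n).Subgraph := (rationalityGraph n).induce (cSet n)

/-- The induced subgraph `Γ_d` of `Γ(D_r)` on `{w_0} ∪ {d_I : I ≠ ∅}`. -/
def dHalf (n : ℕ) : (leftMulGraph n).Subgraph := (rationalityGraph n).induce (dSet n)

/-- The diagram automorphism: `e_j ↦ e_j` for `j < r`, and `e_r ↦ -e_r`. -/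
def tau (n : ℕ) : V n ≃ₗ[ℝ] V n :=
  signedPerm 1 (fun j => if j = Fin.last n then -1 else 1)

end TypeD

namespace TypeD

open Finset

variable {n : ℕ}

/-! An element `u` fails to be rational as soon as some nonempty set of positive roots stays
positive under `u` and each member lies below the image of a member (`not_isRational_of_set`).
Writing `u` as a permutation π with signs ε, one feeds this criterion small sets of roots.

As r is odd, an even number of sign changes leaves some sign positive. The criterion then allows
just one positive sign, at r or at the preimage of r under π (`IsRational.exists_eq_posAt`). If it
is at r, a cycle of adjacent descents would obstruct rationality unless π j ≥ j for all j < r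
(`IsRational.le_apply`). Conversely, such elements are rational, because the leading index of the
roots in ν_k grows with k (`isRational_of_le`). Permutations that decrease only r are exactly the
cycles p_I, with p_∅ = 1 giving w_0 (`exists_eq_pCycle`), so this case yields the c-family.

Conjugation by τ preserves simple roots, order and rationality, and moves the positive sign from r
to the preimage of r (`tau_conj_posAt_last`). It thus exchanges the two families, which settles the
other case and gives the isomorphism. Finally, an edge between the families must have an endpoint in
both (`mem_of_adj`), so no edge is lost in the union. -/

theorem signedPerm_injective {π π' : Equiv.Perm (Fin (n + 1))} {ε ε' : Fin (n + 1) → ℤˣ}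
    (h : signedPerm π ε = signedPerm π' ε') : π = π' ∧ ε = ε' := by
  have key : ∀ j, π j = π' j ∧ ε j = ε' j := by
    intro j
    have hj := LinearEquiv.congr_fun h (e j)
    rw [signedPerm_e, signedPerm_e] at hj
    have h1 := congrFun hj (π j)
    have hπ : π j = π' j := by
      by_contra hne
      simp [e, hne] at h1
    refine ⟨hπ, ?_⟩
    rw [← hπ] at h1
    simp only [e, Pi.smul_apply, Pi.single_eq_same, smul_eq_mul, mul_one, Int.cast_inj] at h1
    exact Units.ext h1
  exact ⟨Equiv.ext fun j => (key j).1, funext fun j => (key j).2⟩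

theorem signedPerm_e_of_pos {π : Equiv.Perm (Fin (n + 1))} {ε : Fin (n + 1) → ℤˣ}
    {j : Fin (n + 1)} (h : ε j = 1) : signedPerm π ε (e j) = e (π j) := by
  rw [signedPerm_e, h]; simp

theorem signedPerm_e_of_neg {π : Equiv.Perm (Fin (n + 1))} {ε : Fin (n + 1) → ℤˣ}
    {j : Fin (n + 1)} (h : ε j = -1) : signedPerm π ε (e j) = -e (π j) := by
  rw [signedPerm_e, h]; simp

/-! ### The root order -/

theorem sub_mem_closure {a b : Fin (n + 1)} (h : a ≤ b) :
    e a - e b ∈ AddSubmonoid.closure (simpleRoots n) := by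
  induction b using Fin.induction with
  | zero =>
    have : a = 0 := le_antisymm h (Fin.zero_le _)
    subst this
    simp
  | succ i ih =>
    rcases h.eq_or_lt with rfl | h
    · simp
    · have hi : a ≤ i.castSucc := Fin.le_castSucc_iff.2 h
      have := add_mem (ih hi) (AddSubmonoid.subset_closure
        (show e i.castSucc - e i.succ ∈ simpleRoots n from Or.inl ⟨i, rfl⟩))
      simpa using this

/-- With a < r, the sum splits as (e_a - e_{r-1}) + (e_b - e_r) + (e_{r-1} + e_r). The hypothesis
excludes 2e_r, which is not in the cone. -/
theorem add_mem_closure {a b : Fin (n + 1)} (h : a ≠ Fin.last n ∨ b ≠ Fin.last n) :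
    e a + e b ∈ AddSubmonoid.closure (simpleRoots n) := by
  wlog ha : a ≠ Fin.last n generalizing a b
  · rw [add_comm (e a) (e b)]
    exact this h.symm (h.resolve_left ha)
  obtain ⟨m, rfl⟩ : ∃ m, n = m + 1 := by
    cases n with
    | zero => exact absurd (Fin.ext (by simp)) ha
    | succ m => exact ⟨m, rfl⟩
  have h1 : a ≤ (Fin.last m).castSucc := by
    rw [Fin.le_castSucc_iff, Fin.succ_last]
    exact Fin.lt_last_iff_ne_last.2 ha
  have h2 := add_mem (add_mem (sub_mem_closure h1) (sub_mem_closure (Fin.le_last b)))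
    (AddSubmonoid.subset_closure (show e (Fin.last m).castSucc + e (Fin.last m).succ ∈
      simpleRoots (m + 1) from Or.inr ⟨Fin.last m, Fin.succ_last m, rfl⟩))
  convert h2 using 1
  rw [Fin.succ_last]
  abel

theorem rootLE_sub_sub {i j a b : Fin (n + 1)} (h : a ≤ i) (h' : j ≤ b) :
    RootLE (e i - e j) (e a - e b) := by
  have := add_mem (sub_mem_closure h) (sub_mem_closure h')
  rw [RootLE]; convert this using 1; abel

theorem rootLE_add_add {i j a b : Fin (n + 1)} (h : a ≤ i) (h' : b ≤ j) :
    RootLE (e i + e j) (e a + e b) := by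
  have := add_mem (sub_mem_closure h) (sub_mem_closure h')
  rw [RootLE]; convert this using 1; abel

theorem rootLE_sub_add {i k a b : Fin (n + 1)} (h : a ≤ i)
    (h' : b ≠ Fin.last n ∨ k ≠ Fin.last n) : RootLE (e i - e k) (e a + e b) := by
  have := add_mem (sub_mem_closure h) (add_mem_closure h')
  rw [RootLE]; convert this using 1; abel

theorem sum_Iic_e (j k : Fin (n + 1)) :
    ∑ i ∈ Iic k, (e j : V n) i = if j ≤ k then 1 else 0 := by
  simp [e, Finset.sum_pi_single']

/-- Each initial sum of coordinates is nonnegative on every simple root. These functionals suffice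
to refute all the order relations needed below. -/
theorem RootLE.sum_Iic_le {ρ η : V n} (h : RootLE ρ η) (k : Fin (n + 1)) :
    ∑ i ∈ Iic k, ρ i ≤ ∑ i ∈ Iic k, η i := by
  have key : ∀ x ∈ AddSubmonoid.closure (simpleRoots n), 0 ≤ ∑ i ∈ Iic k, x i := by
    intro x hx
    induction hx using AddSubmonoid.closure_induction with
    | mem x hx =>
      rcases hx with ⟨i, rfl⟩ | ⟨i, -, rfl⟩
      · simp only [Pi.sub_apply, sum_sub_distrib, sum_Iic_e]
        have : i.castSucc < i.succ := Fin.castSucc_lt_succ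
        split_ifs with h1 h2 <;> try norm_num
        exact absurd (this.le.trans ‹_›) h1
      · simp only [Pi.add_apply, sum_add_distrib, sum_Iic_e]
        split_ifs <;> norm_num
    | zero => simp
    | add x y _ _ hx hy => simpa [sum_add_distrib] using add_nonneg hx hy
  have := key _ h
  simpa [sum_sub_distrib] using this

theorem sub_mem_posRoots {i j : Fin (n + 1)} (h : i < j) : e i - e j ∈ posRoots n :=
  Or.inl ⟨i, j, h, rfl⟩

theorem add_mem_posRoots {i j : Fin (n + 1)} (h : i ≠ j) : e i + e j ∈ posRoots n := by
  rcases h.lt_or_gt with h | h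
  · exact Or.inr ⟨i, j, h, rfl⟩
  · exact Or.inr ⟨j, i, h, add_comm _ _⟩

theorem rootLE_zero_of_mem_posRoots {x : V n} (h : x ∈ posRoots n) : RootLE 0 x := by
  rw [RootLE, sub_zero]
  rcases h with ⟨i, j, h, rfl⟩ | ⟨i, j, h, rfl⟩
  · exact sub_mem_closure h.le
  · exact add_mem_closure (Or.inl (Fin.lt_last_iff_ne_last.1 (h.trans_le (Fin.le_last j))))

theorem not_rootLE_add_sub (i j a b : Fin (n + 1)) : ¬ RootLE (e i + e j) (e a - e b) := by
  intro h
  have := h.sum_Iic_le (Fin.last n)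
  simp only [Pi.add_apply, Pi.sub_apply, sum_sub_distrib, sum_add_distrib, sum_Iic_e,
    Fin.le_last, if_true] at this
  norm_num at this

theorem neg_add_neg_notMem_posRoots (i j : Fin (n + 1)) : -e i + -e j ∉ posRoots n := by
  intro h
  have := (rootLE_zero_of_mem_posRoots h).sum_Iic_le (Fin.last n)
  simp only [Pi.add_apply, Pi.neg_apply, sum_neg_distrib, sum_add_distrib, sum_Iic_e,
    Fin.le_last, if_true, Pi.zero_apply, sum_const_zero] at this
  norm_num at this

theorem lt_of_sub_mem_posRoots {a b : Fin (n + 1)} (hab : a ≠ b) (h : e a - e b ∈ posRoots n) :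
    a < b := by
  by_contra hba
  have hlt : b < a := lt_of_le_of_ne (not_lt.1 hba) hab.symm
  have := (rootLE_zero_of_mem_posRoots h).sum_Iic_le b
  simp only [Pi.sub_apply, sum_sub_distrib, sum_Iic_e, Pi.zero_apply, sum_const_zero,
    if_neg (not_le.2 hlt), le_refl, if_true] at this
  norm_num at this

theorem RootLE.le_of_sub_sub {i j a b : Fin (n + 1)} (hij : i < j) (hab : a < b)
    (h : RootLE (e i - e j) (e a - e b)) : a ≤ i := by
  by_contra hia
  rw [not_le] at hia
  have := h.sum_Iic_le i
  simp only [Pi.sub_apply, sum_sub_distrib, sum_Iic_e, le_refl, if_true, if_neg (not_le.2 hij),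
    if_neg (not_le.2 hia), if_neg (not_le.2 (hia.trans hab))] at this
  norm_num at this

/-! ### Criteria for rationality -/

/-- A nonempty set of positive roots that is sent to positive roots, each of its members lying below
the image of another one, obstructs rationality. -/
theorem not_isRational_of_set {u : V n ≃ₗ[ℝ] V n} (G : Set (V n)) (hG : G.Nonempty)
    (hpos : G ⊆ posRoots n) (hu : ∀ γ ∈ G, u γ ∈ posRoots n)
    (hle : ∀ γ ∈ G, ∃ γ' ∈ G, RootLE γ (u γ')) : ¬ IsRational u := by
  rintro ⟨K, hK⟩
  have key : ∀ k, u '' G ⊆ nu u k := by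
    intro k
    induction k with
    | zero => rintro _ ⟨γ, hγ, rfl⟩; exact ⟨⟨γ, hpos hγ, rfl⟩, hu γ hγ⟩
    | succ k ih =>
      rintro _ ⟨γ, hγ, rfl⟩
      obtain ⟨γ', hγ', hl⟩ := hle γ hγ
      exact ⟨⟨γ, ⟨hpos hγ, u γ', ih ⟨γ', hγ', rfl⟩, hl⟩, rfl⟩, hu γ hγ⟩
  obtain ⟨γ, hγ⟩ := hG
  have := key K ⟨γ, hγ, rfl⟩
  rw [hK K le_rfl] at this
  exact this

theorem not_isRational_of_rootLE {u : V n ≃ₗ[ℝ] V n} {γ : V n} (hγ : γ ∈ posRoots n)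
    (hu : u γ ∈ posRoots n) (hle : RootLE γ (u γ)) : ¬ IsRational u :=
  not_isRational_of_set {γ} (Set.singleton_nonempty γ) (by simpa using hγ) (by simpa using hu)
    (by simpa using hle)

/-- The sign vector that is positive at `j` only. -/
def posAt (j : Fin (n + 1)) : Fin (n + 1) → ℤˣ := fun i => if i = j then 1 else -1

/-- A sum root never lies below a difference root, so after ν_0 only differences contribute. If e_i
- e_j ≤ e_a - e_b has a positive image, that image is e_{π j} - e_{π i} with a ≤ i < j ≤ π j: the
leading index strictly increases and eventually runs out. -/
theorem isRational_of_le {π : Equiv.Perm (Fin (n + 1))}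
    (hπ : ∀ j, j ≠ Fin.last n → j ≤ π j) : IsRational (signedPerm π (posAt (Fin.last n))) := by
  set u := signedPerm π (posAt (Fin.last n)) with hu
  have hlast : u (e (Fin.last n)) = e (π (Fin.last n)) := signedPerm_e_of_pos (by simp [posAt])
  have hne : ∀ j, j ≠ Fin.last n → u (e j) = -e (π j) := fun j hj =>
    signedPerm_e_of_neg (by simp [posAt, hj])
  have hsub : ∀ i j, i < j → u (e i - e j) ∈ posRoots n →
      i < π j ∧ π j < π i ∧ u (e i - e j) = e (π j) - e (π i) := by
    intro i j hij h
    have hi : i ≠ Fin.last n := Fin.lt_last_iff_ne_last.1 (hij.trans_le (Fin.le_last j))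
    by_cases hj : j = Fin.last n
    · subst hj
      rw [map_sub, hlast, hne i hi, sub_eq_add_neg] at h
      exact absurd h (neg_add_neg_notMem_posRoots _ _)
    · rw [map_sub, hne i hi, hne j hj, neg_sub_neg] at h ⊢
      exact ⟨hij.trans_le (hπ j hj), lt_of_sub_mem_posRoots (π.injective.ne hij.ne') h, rfl⟩
  have hadd : ∀ i j, i < j → u (e i + e j) ∈ posRoots n →
      ∃ a b, a < b ∧ u (e i + e j) = e a - e b := by
    intro i j hij h
    have hi : i ≠ Fin.last n := Fin.lt_last_iff_ne_last.1 (hij.trans_le (Fin.le_last j))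
    by_cases hj : j = Fin.last n
    · subst hj
      rw [map_add, hlast, hne i hi, neg_add_eq_sub] at h ⊢
      exact ⟨_, _, lt_of_sub_mem_posRoots (π.injective.ne hij.ne') h, rfl⟩
    · rw [map_add, hne i hi, hne j hj] at h
      exact absurd h (neg_add_neg_notMem_posRoots _ _)
  have key : ∀ k, ∀ β ∈ nu u k, ∃ a b : Fin (n + 1), a < b ∧ k ≤ (a : ℕ) ∧ β = e a - e b := by
    intro k
    induction k with
    | zero =>
      rintro _ ⟨⟨γ, ⟨i, j, hij, rfl⟩ | ⟨i, j, hij, rfl⟩, rfl⟩, hp⟩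
      · obtain ⟨-, h1, h2⟩ := hsub i j hij hp
        exact ⟨_, _, h1, Nat.zero_le _, h2⟩
      · obtain ⟨a, b, h1, h2⟩ := hadd i j hij hp
        exact ⟨a, b, h1, Nat.zero_le _, h2⟩
    | succ k ih =>
      rintro _ ⟨⟨γ, ⟨hγ, β, hβ, hle⟩, rfl⟩, hp⟩
      obtain ⟨a, b, hab, hk, rfl⟩ := ih β hβ
      rcases hγ with ⟨i, j, hij, rfl⟩ | ⟨i, j, hij, rfl⟩
      · obtain ⟨h0, h1, h2⟩ := hsub i j hij hp
        have hai := hle.le_of_sub_sub hij hab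
        exact ⟨_, _, h1, by have := Fin.lt_def.1 h0; have := Fin.le_def.1 hai; omega, h2⟩
      · exact absurd hle (not_rootLE_add_sub _ _ _ _)
  refine ⟨n + 1, fun k hk => Set.eq_empty_of_forall_notMem fun β hβ => ?_⟩
  obtain ⟨a, -, -, ha, -⟩ := key k β hβ
  omega

/-! ### Rational elements have exactly one positive sign -/

section Signs

variable {π : Equiv.Perm (Fin (n + 1))} {ε : Fin (n + 1) → ℤˣ}

/-- The root e_q - e_k goes to e_{π q} + e_{π k} and lies below it, unless the difference would
contain 2e_r. The primed version pairs π k with q instead. -/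
theorem IsRational.last_of_apply_le (h : IsRational (signedPerm π ε)) {q k : Fin (n + 1)}
    (hq : ε q = 1) (hk : ε k = -1) (hqk : q < k) (hle : π q ≤ q) :
    k = Fin.last n ∧ π k = Fin.last n := by
  by_contra hne
  have hu : signedPerm π ε (e q - e k) = e (π q) + e (π k) := by
    rw [map_sub, signedPerm_e_of_pos hq, signedPerm_e_of_neg hk, sub_neg_eq_add]
  refine not_isRational_of_rootLE (sub_mem_posRoots hqk) ?_ ?_ h
  · rw [hu]; exact add_mem_posRoots (π.injective.ne hqk.ne)
  · rw [hu]; exact rootLE_sub_add hle (by tauto)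

theorem IsRational.last_of_apply_le' (h : IsRational (signedPerm π ε)) {q k : Fin (n + 1)}
    (hq : ε q = 1) (hk : ε k = -1) (hqk : q < k) (hle : π k ≤ q) :
    k = Fin.last n ∧ π q = Fin.last n := by
  by_contra hne
  have hu : signedPerm π ε (e q - e k) = e (π k) + e (π q) := by
    rw [map_sub, signedPerm_e_of_pos hq, signedPerm_e_of_neg hk, sub_neg_eq_add, add_comm]
  refine not_isRational_of_rootLE (sub_mem_posRoots hqk) ?_ ?_ h
  · rw [hu]; exact add_mem_posRoots (π.injective.ne hqk.ne')
  · rw [hu]; exact rootLE_sub_add hle (by tauto)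

theorem IsRational.lt_apply_of_pos (h : IsRational (signedPerm π ε)) {q j : Fin (n + 1)}
    (hq : ε q = 1) (hj : ε j = 1) (hne : j ≠ q) (hlq : π q ≤ q) (hlj : π q ≤ j) :
    q < π j ∧ j < π j := by
  have hu : signedPerm π ε (e q + e j) = e (π q) + e (π j) := by
    rw [map_add, signedPerm_e_of_pos hq, signedPerm_e_of_pos hj]
  have hpos : signedPerm π ε (e q + e j) ∈ posRoots n := by
    rw [hu]; exact add_mem_posRoots (π.injective.ne hne.symm)
  constructor <;> by_contra hlt <;> rw [not_lt] at hlt <;>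
    refine not_isRational_of_rootLE (add_mem_posRoots hne.symm) hpos ?_ h <;> rw [hu]
  · rw [add_comm (e q)]; exact rootLE_add_add hlj hlt
  · exact rootLE_add_add hlq hlt

theorem IsRational.not_lt_of_pos (h : IsRational (signedPerm π ε)) {q j : Fin (n + 1)}
    (hq : ε q = 1) (hj : ε j = 1) (hlq : π q ≤ q) (hlj : j < π j) : ¬ q < j := by
  intro hqj
  have hu : signedPerm π ε (e q - e j) = e (π q) - e (π j) := by
    rw [map_sub, signedPerm_e_of_pos hq, signedPerm_e_of_pos hj]
  refine not_isRational_of_rootLE (sub_mem_posRoots hqj) ?_ ?_ h <;> rw [hu]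
  · exact sub_mem_posRoots (hlq.trans_lt (hqj.trans hlj))
  · exact rootLE_sub_sub hlq hlj.le

/-- A single root does not suffice here: e_q - e_r and e_q + e_r have their signs at r interchanged
by the element, so each lies below the image of the other. -/
theorem IsRational.not_apply_last (h : IsRational (signedPerm π ε)) {q : Fin (n + 1)}
    (hq : ε q = 1) (hl : ε (Fin.last n) = -1) (hle : π q ≤ q) :
    π (Fin.last n) ≠ Fin.last n := by
  intro hlast
  have hne : q ≠ Fin.last n := by rintro rfl; rw [hq] at hl; exact absurd hl (by decide)
  have hlt : q < Fin.last n := Fin.lt_last_iff_ne_last.2 hne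
  have hlt' : π q < Fin.last n := hle.trans_lt hlt
  have h1 : signedPerm π ε (e q - e (Fin.last n)) = e (π q) + e (Fin.last n) := by
    rw [map_sub, signedPerm_e_of_pos hq, signedPerm_e_of_neg hl, hlast, sub_neg_eq_add]
  have h2 : signedPerm π ε (e q + e (Fin.last n)) = e (π q) - e (Fin.last n) := by
    rw [map_add, signedPerm_e_of_pos hq, signedPerm_e_of_neg hl, hlast, sub_eq_add_neg]
  refine not_isRational_of_set {e q - e (Fin.last n), e q + e (Fin.last n)} ⟨_, Or.inl rfl⟩
    ?_ ?_ ?_ h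
  · rintro _ (rfl | rfl)
    exacts [sub_mem_posRoots hlt, add_mem_posRoots hne]
  · rintro _ (rfl | rfl)
    · rw [h1]; exact add_mem_posRoots hlt'.ne
    · rw [h2]; exact sub_mem_posRoots hlt'
  · rintro _ (rfl | rfl)
    · exact ⟨_, Or.inr rfl, by rw [h2]; exact rootLE_sub_sub hle le_rfl⟩
    · exact ⟨_, Or.inl rfl, by rw [h1]; exact rootLE_add_add hle le_rfl⟩

theorem IsRational.eq_last_of_apply_le (h : IsRational (signedPerm π ε)) {m q : Fin (n + 1)}
    (hm : ∀ j, ε j = 1 → m ≤ j) (hq : ε q = 1) (hle : π q ≤ m) :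
    q = Fin.last n ∧ ∀ j, ε j = 1 → j = Fin.last n := by
  have hlq : π q ≤ q := hle.trans (hm q hq)
  have key : ∀ j, ε j = 1 → j ≠ q → q < π j ∧ j < π j := fun j hj hne =>
    h.lt_apply_of_pos hq hj hne hlq (hle.trans (hm j hj))
  have hqlast : q = Fin.last n := by
    by_contra hne
    have hlt : q < Fin.last n := Fin.lt_last_iff_ne_last.2 hne
    rcases Int.units_eq_one_or (ε (Fin.last n)) with hl | hl
    · exact h.not_lt_of_pos hq hl hlq (key _ hl (Ne.symm hne)).2 hlt
    · exact h.not_apply_last hq hl hlq (h.last_of_apply_le hq hl hlt hlq).2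
  refine ⟨hqlast, fun j hj => ?_⟩
  by_contra hne
  -- Another positive index would have its image strictly above q, which is the last index.
  have := (key j hj (by rw [hqlast]; exact hne)).1
  rw [hqlast] at this
  exact absurd this (not_lt.2 (Fin.le_last _))

theorem IsRational.apply_eq_last_of_lt_apply (h : IsRational (signedPerm π ε)) {m : Fin (n + 1)}
    (hεm : ε m = 1) (hm : ∀ j, ε j = 1 → m ≤ j) (hlt : ∀ j, ε j = 1 → m < π j) :
    π m = Fin.last n ∧ ∀ j, ε j = 1 → j = m := by
  obtain ⟨k, hmk, hkm⟩ : ∃ k, m < k ∧ π k ≤ m := by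
    by_contra hne
    push Not at hne
    -- Pigeonhole: if nothing above m landed at or below m, all values up to m would come from
    -- indices strictly below m, one too few.
    have hmaps : ∀ v ∈ Iic m, π.symm v ∈ Iio m := by
      intro v hv
      rw [mem_Iic] at hv
      rw [mem_Iio]
      by_contra hge
      rcases (not_lt.1 hge).eq_or_lt with heq | hgt
      · have := hlt m hεm
        rw [heq, Equiv.apply_symm_apply, ← heq] at this
        exact absurd hv (not_le.2 this)
      · have := hne _ hgt
        rw [Equiv.apply_symm_apply] at this
        exact absurd hv (not_le.2 this)
    have := card_le_card_of_injOn _ hmaps π.symm.injective.injOn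
    simp only [Fin.card_Iic, Fin.card_Iio] at this
    omega
  have hεk : ε k = -1 :=
    (Int.units_eq_one_or _).resolve_left fun hk => absurd hkm (not_le.2 (hlt k hk))
  obtain ⟨hk, hπ⟩ := h.last_of_apply_le' hεm hεk hmk hkm
  refine ⟨hπ, fun j hj => ?_⟩
  have hjk : j < k := by
    rw [hk, Fin.lt_last_iff_ne_last]
    rintro rfl
    rw [hk, hj] at hεk
    exact absurd hεk (by decide)
  have := (h.last_of_apply_le' hj hεk hjk (hkm.trans (hm j hj))).2
  exact π.injective (this.trans hπ.symm)

theorem eq_posAt_of_unique {m : Fin (n + 1)} (hm : ε m = 1) (h : ∀ j, ε j = 1 → j = m) :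
    ε = posAt m := by
  funext j
  by_cases hj : j = m
  · simp [posAt, hj, hm]
  · simpa [posAt, hj] using (Int.units_eq_one_or (ε j)).resolve_left fun h' => hj (h j h')

/-- A rational element with a positive sign has only one, and the corresponding basis vector is or
is sent to the last one. -/
theorem IsRational.exists_eq_posAt (h : IsRational (signedPerm π ε)) (hε : ∃ j, ε j = 1) :
    ∃ m, ε = posAt m ∧ (m = Fin.last n ∨ π m = Fin.last n) := by
  obtain ⟨m, hm, hmin⟩ : ∃ m, ε m = 1 ∧ ∀ j, ε j = 1 → m ≤ j := by
    have hne : (univ.filter fun j => ε j = 1).Nonempty := by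
      obtain ⟨j, hj⟩ := hε
      exact ⟨j, by simpa using hj⟩
    exact ⟨_, (mem_filter.1 (min'_mem _ hne)).2, fun j hj => min'_le _ _ (by simpa using hj)⟩
  by_cases hq : ∃ q, ε q = 1 ∧ π q ≤ m
  · obtain ⟨q, hq, hle⟩ := hq
    obtain ⟨rfl, hu⟩ := h.eq_last_of_apply_le hmin hq hle
    exact ⟨_, eq_posAt_of_unique hq hu, Or.inl rfl⟩
  · push Not at hq
    obtain ⟨hπ, hu⟩ := h.apply_eq_last_of_lt_apply hm hmin hq
    exact ⟨m, eq_posAt_of_unique hm hu, Or.inr hπ⟩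

end Signs

/-- If the position of `t` is crossed downwards then so is that of some adjacent descent. -/
theorem exists_adjacent_descent (π : Equiv.Perm (Fin (n + 1))) {t : Fin (n + 1)}
    (ht : ∃ j, t < j ∧ j ≠ Fin.last n ∧ π j ≤ t) :
    ∃ s : Fin n, s.succ ≠ Fin.last n ∧ t < π s.castSucc ∧ π s.succ ≤ t ∧
      ∃ j, s.castSucc < j ∧ j ≠ Fin.last n ∧ π j ≤ s.castSucc := by
  obtain ⟨j, htj, hj, hjt⟩ := ht
  -- Some index below j has image above t, since the indices up to j do not fit into the values up
  -- to t < j. The largest such index gives the descent.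
  obtain ⟨i, hij, hi, hmax⟩ : ∃ i, i < j ∧ t < π i ∧ ∀ k, i < k → k ≤ j → π k ≤ t := by
    have hne : (univ.filter fun i => i < j ∧ t < π i).Nonempty := by
      by_contra hemp
      rw [not_nonempty_iff_eq_empty, filter_eq_empty_iff] at hemp
      have hmaps : ∀ i ∈ Iic j, π i ∈ Iic t := by
        intro i hi
        rw [mem_Iic] at hi ⊢
        rcases hi.eq_or_lt with rfl | hi
        · exact hjt
        · exact not_lt.1 fun h => hemp (mem_univ i) ⟨hi, h⟩
      have := card_le_card_of_injOn _ hmaps π.injective.injOn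
      simp only [Fin.card_Iic] at this
      have := Fin.lt_def.1 htj
      omega
    have hmem := max'_mem _ hne
    rw [mem_filter] at hmem
    refine ⟨_, hmem.2.1, hmem.2.2, fun k hk hkj => ?_⟩
    rcases hkj.eq_or_lt with rfl | hkj
    · exact hjt
    · by_contra hlt
      exact absurd (le_max' _ k (by simpa using ⟨hkj, not_le.1 hlt⟩)) (not_le.2 hk)
  obtain ⟨s, rfl⟩ := Fin.exists_castSucc_eq.2
    (Fin.lt_last_iff_ne_last.1 (hij.trans_le (Fin.le_last j)))
  have hsj : s.succ ≤ j := Fin.castSucc_lt_iff_succ_le.1 hij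
  have hs : s.succ ≠ Fin.last n := fun h =>
    hj (le_antisymm (Fin.le_last j) (h ▸ hsj))
  refine ⟨s, hs, hi, hmax _ Fin.castSucc_lt_succ hsj, ?_⟩
  by_contra! hno
  -- Without a crossing at s, the indices in (s, j] would inject into (s, t], which is smaller
  -- because t < j.
  have hmaps : ∀ k ∈ Ioc s.castSucc j, π k ∈ Ioc s.castSucc t := by
    intro k hk
    rw [mem_Ioc] at hk ⊢
    refine ⟨hno k hk.1 ?_, hmax k hk.1 hk.2⟩
    rintro rfl
    exact hj (le_antisymm (Fin.le_last j) hk.2)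
  have := card_le_card_of_injOn _ hmaps π.injective.injOn
  simp only [Fin.card_Ioc] at this
  have := Fin.lt_def.1 htj
  have := Fin.lt_def.1 hij
  omega

/-- For a rational element whose only positive sign is the last one, the permutation does not
decrease any other index. -/
theorem IsRational.le_apply {π : Equiv.Perm (Fin (n + 1))}
    (h : IsRational (signedPerm π (posAt (Fin.last n)))) {j : Fin (n + 1)}
    (hj : j ≠ Fin.last n) : j ≤ π j := by
  by_contra hlt
  rw [not_le] at hlt
  have hgood : ∃ t : Fin (n + 1), ∃ j, t < j ∧ j ≠ Fin.last n ∧ π j ≤ t :=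
    ⟨π j, j, hlt, hj, le_rfl⟩
  have hu : ∀ s : Fin n, s.succ ≠ Fin.last n → signedPerm π (posAt (Fin.last n))
      (e s.castSucc - e s.succ) = e (π s.succ) - e (π s.castSucc) := by
    intro s hs
    rw [map_sub, signedPerm_e_of_neg, signedPerm_e_of_neg (j := s.succ), neg_sub_neg]
    · simp [posAt, hs]
    · simp [posAt, (Fin.castSucc_lt_last s).ne]
  -- The crossing condition at s makes the set self-sustaining: applied with t = s,
  -- `exists_adjacent_descent` returns another member, whose image dominates e_s - e_{s+1}.
  let G : Set (V n) := {γ | ∃ s : Fin n, s.succ ≠ Fin.last n ∧ π s.succ < π s.castSucc ∧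
    (∃ j, s.castSucc < j ∧ j ≠ Fin.last n ∧ π j ≤ s.castSucc) ∧ γ = e s.castSucc - e s.succ}
  refine not_isRational_of_set G ?_ ?_ ?_ ?_ h
  · obtain ⟨t, ht⟩ := hgood
    obtain ⟨s, hs, h1, h2, h3⟩ := exists_adjacent_descent π ht
    exact ⟨_, s, hs, h2.trans_lt h1, h3, rfl⟩
  · rintro _ ⟨s, -, -, -, rfl⟩
    exact sub_mem_posRoots Fin.castSucc_lt_succ
  · rintro _ ⟨s, hs, h1, -, rfl⟩
    rw [hu s hs]
    exact sub_mem_posRoots h1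
  · rintro _ ⟨s, -, -, h3, rfl⟩
    obtain ⟨s', hs', h1', h2', h3'⟩ := exists_adjacent_descent π h3
    refine ⟨_, ⟨s', hs', h2'.trans_lt h1', h3', rfl⟩, ?_⟩
    rw [hu s' hs']
    exact rootLE_sub_sub h2' (Fin.castSucc_lt_iff_succ_le.1 h1')

/-! ### The cycles `p_I` -/

/-- The permutations that do not decrease any index but the last one. -/
def weakExc (n : ℕ) : Set (Equiv.Perm (Fin (n + 1))) :=
  {π | ∀ j, j ≠ Fin.last n → j ≤ π j}

/-- The list of entries of the cycle `p_I`. -/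
def cycleList (I : Finset (Fin n)) : List (Fin (n + 1)) :=
  I.sort.map Fin.castSucc ++ [Fin.last n]

theorem pairwise_cycleList (I : Finset (Fin n)) : (cycleList I).Pairwise (· < ·) := by
  rw [cycleList, List.pairwise_append]
  refine ⟨?_, List.pairwise_singleton _ _, ?_⟩
  · rw [List.pairwise_map]
    exact (sortedLT_sort I).pairwise.imp fun h => Fin.castSucc_lt_castSucc_iff.2 h
  · simp only [List.mem_map, List.mem_singleton, forall_eq]
    rintro _ ⟨i, -, rfl⟩
    exact Fin.castSucc_lt_last i

theorem nodup_cycleList (I : Finset (Fin n)) : (cycleList I).Nodup :=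
  (pairwise_cycleList I).imp ne_of_lt

theorem last_mem_cycleList (I : Finset (Fin n)) : Fin.last n ∈ cycleList I := by
  simp [cycleList]

theorem castSucc_mem_cycleList {I : Finset (Fin n)} {i : Fin n} :
    i.castSucc ∈ cycleList I ↔ i ∈ I := by
  simp [cycleList, (Fin.castSucc_lt_last i).ne]

theorem getElem_cycleList_eq_last {I : Finset (Fin n)} {k : ℕ} (hk : k < (cycleList I).length)
    (h : k + 1 = (cycleList I).length) : (cycleList I)[k] = Fin.last n := by
  simp only [cycleList, List.length_append, List.length_singleton] at h
  have : k = (I.sort.map Fin.castSucc).length := by omega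
  subst this
  simp [cycleList]

theorem lt_pCycle_of_mem {I : Finset (Fin n)} {j : Fin (n + 1)} (hj : j ≠ Fin.last n)
    (hmem : j ∈ cycleList I) : j < pCycle I j := by
  obtain ⟨k, hk, rfl⟩ := List.getElem_of_mem hmem
  have hk' : k + 1 < (cycleList I).length := by
    by_contra hlt
    exact hj (getElem_cycleList_eq_last hk (by omega))
  have : pCycle I (cycleList I)[k] = (cycleList I)[k + 1] :=
    List.formPerm_apply_lt_getElem _ (nodup_cycleList I) k hk'
  rw [this]
  exact List.pairwise_iff_getElem.1 (pairwise_cycleList I) k (k + 1) hk hk' (Nat.lt_succ_self k)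

theorem pCycle_of_notMem {I : Finset (Fin n)} {j : Fin (n + 1)} (hmem : j ∉ cycleList I) :
    pCycle I j = j :=
  List.formPerm_apply_of_notMem hmem

theorem pCycle_mem_weakExc (I : Finset (Fin n)) : pCycle I ∈ weakExc n := by
  intro j hj
  by_cases hmem : j ∈ cycleList I
  · exact (lt_pCycle_of_mem hj hmem).le
  · exact (pCycle_of_notMem hmem).ge

theorem pCycle_empty : pCycle (∅ : Finset (Fin n)) = 1 := by
  simp [pCycle]

theorem pCycle_max' {I : Finset (Fin n)} (hI : I.Nonempty) :
    pCycle I (I.max' hI).castSucc = Fin.last n := by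
  have hmem : (I.max' hI).castSucc ∈ cycleList I := castSucc_mem_cycleList.2 (max'_mem _ _)
  have hlt := lt_pCycle_of_mem (Fin.castSucc_lt_last _).ne hmem
  have hmem' : pCycle I (I.max' hI).castSucc ∈ cycleList I :=
    List.formPerm_apply_mem_of_mem hmem
  by_contra hne
  obtain ⟨i, hi⟩ := Fin.exists_castSucc_eq.2 hne
  rw [← hi] at hlt hmem'
  exact absurd (le_max' I i (castSucc_mem_cycleList.1 hmem'))
    (not_le.2 (Fin.castSucc_lt_castSucc_iff.1 hlt))

/-- Take I to be the moved indices below r. Each must go to a later entry of the list. Working back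
from the end, all entries beyond the next one are already taken as images, so π goes to the next;
bijectivity then fixes the image of r. -/
theorem exists_eq_pCycle {π : Equiv.Perm (Fin (n + 1))} (hπ : π ∈ weakExc n) :
    ∃ I, π = pCycle I := by
  let I : Finset (Fin n) := univ.filter fun i => π i.castSucc ≠ i.castSucc
  have hmem : ∀ j, j ≠ Fin.last n → (j ∈ cycleList I ↔ π j ≠ j) := by
    intro j hj
    obtain ⟨i, rfl⟩ := Fin.exists_castSucc_eq.2 hj
    simp [castSucc_mem_cycleList, I]
  have hstep : ∀ d k (hk : k + 1 < (cycleList I).length), (cycleList I).length - k = d →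
      π (cycleList I)[k] = (cycleList I)[k + 1] := by
    intro d
    induction d using Nat.strong_induction_on with
    | _ d ih =>
      intro k hk hd
      have hlt := List.pairwise_iff_getElem.1 (pairwise_cycleList I)
      have hne : (cycleList I)[k] ≠ Fin.last n :=
        ((hlt k (k + 1) (by omega) hk (by omega)).trans_le (Fin.le_last _)).ne
      have hmov := (hmem _ hne).1 (List.getElem_mem _)
      have hgt : (cycleList I)[k] < π (cycleList I)[k] := lt_of_le_of_ne (hπ _ hne) hmov.symm
      have hin : π (cycleList I)[k] ∈ cycleList I := by
        by_cases hl : π (cycleList I)[k] = Fin.last n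
        · rw [hl]; exact last_mem_cycleList I
        · exact (hmem _ hl).2 (π.injective.ne hmov)
      obtain ⟨m, hm, hmk⟩ := List.getElem_of_mem hin
      have hkm : k < m := by
        by_contra hmk'
        rw [← hmk] at hgt
        rcases (not_lt.1 hmk').eq_or_lt with rfl | h
        · exact lt_irrefl _ hgt
        · exact lt_asymm hgt (hlt m k hm (by omega) h)
      rcases Nat.exists_eq_add_of_lt hkm with ⟨c, rfl⟩
      rcases Nat.eq_zero_or_pos c with rfl | hc
      · exact hmk.symm
      · have h1 := ih ((cycleList I).length - (k + c)) (by omega) (k + c) hm rfl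
        have h2 := π.injective (h1.trans hmk)
        exact absurd h2 (hlt k (k + c) (by omega) (by omega) (by omega)).ne'
  refine ⟨I, Equiv.ext fun j => ?_⟩
  have key : ∀ j, j ≠ Fin.last n → π j = pCycle I j := by
    intro j hj
    by_cases hjm : j ∈ cycleList I
    · obtain ⟨k, hk, rfl⟩ := List.getElem_of_mem hjm
      have hk' : k + 1 < (cycleList I).length := by
        by_contra hlt
        exact hj (getElem_cycleList_eq_last hk (by omega))
      rw [hstep _ k hk' rfl]
      exact (List.formPerm_apply_lt_getElem _ (nodup_cycleList I) k hk').symm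
    · rw [pCycle_of_notMem hjm]
      simpa using (hmem j hj).not.1 hjm
  by_cases hj : j = Fin.last n
  · subst hj
    by_contra hne
    have h1 : (pCycle I).symm (π (Fin.last n)) ≠ Fin.last n := fun h =>
      hne (by rw [← h, Equiv.apply_symm_apply, h])
    have h2 := key _ h1
    rw [Equiv.apply_symm_apply] at h2
    exact h1 (π.injective h2)
  · exact key j hj

theorem mem_cSet {u : V n ≃ₗ[ℝ] V n} :
    u ∈ cSet n ↔ ∃ π ∈ weakExc n, u = signedPerm π (posAt (Fin.last n)) := by
  constructor
  · rintro (rfl | ⟨I, -, rfl⟩)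
    · exact ⟨1, fun j _ => le_rfl, rfl⟩
    · exact ⟨pCycle I, pCycle_mem_weakExc I, rfl⟩
  · rintro ⟨π, hπ, rfl⟩
    obtain ⟨I, rfl⟩ := exists_eq_pCycle hπ
    rcases I.eq_empty_or_nonempty with rfl | hI
    · left; rw [pCycle_empty]; rfl
    · exact Or.inr ⟨I, hI, rfl⟩

/-- The positive index i_k of d_I is the preimage of r under p_I; for I empty it is r itself, which
gives w_0. -/
theorem mem_dSet {u : V n ≃ₗ[ℝ] V n} :
    u ∈ dSet n ↔ ∃ π ∈ weakExc n, u = signedPerm π (posAt (π.symm (Fin.last n))) := by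
  have hd : ∀ (I : Finset (Fin n)) (hI : I.Nonempty),
      dElt I hI = signedPerm (pCycle I) (posAt ((pCycle I).symm (Fin.last n))) := by
    intro I hI
    rw [← pCycle_max' hI, Equiv.symm_apply_apply]
    rfl
  constructor
  · rintro (rfl | ⟨I, hI, rfl⟩)
    · exact ⟨1, fun j _ => le_rfl, rfl⟩
    · exact ⟨pCycle I, pCycle_mem_weakExc I, hd I hI⟩
  · rintro ⟨π, hπ, rfl⟩
    obtain ⟨I, rfl⟩ := exists_eq_pCycle hπ
    rcases I.eq_empty_or_nonempty with rfl | hI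
    · left; rw [pCycle_empty]; rfl
    · exact Or.inr ⟨I, hI, (hd I hI).symm⟩

/-! ### The diagram automorphism -/

theorem tau_mul_self (n : ℕ) : tau n * tau n = 1 := by
  rw [tau, signedPerm_mul, ← signedPerm_one n]
  congr 1
  funext j
  exact Int.units_mul_self _

theorem tau_inv (n : ℕ) : (tau n)⁻¹ = tau n :=
  inv_eq_of_mul_eq_one_left (tau_mul_self n)

theorem tau_tau (x : V n) : tau n (tau n x) = x :=
  LinearEquiv.congr_fun (tau_mul_self n) x

theorem tau_e {j : Fin (n + 1)} (hj : j ≠ Fin.last n) : tau n (e j) = e j := by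
  rw [tau, signedPerm_e_of_pos (by simp [hj])]; rfl

theorem tau_e_last : tau n (e (Fin.last n)) = -e (Fin.last n) := by
  rw [tau, signedPerm_e_of_neg (by simp)]; rfl

theorem tau_conj_signedPerm (π : Equiv.Perm (Fin (n + 1))) (ε : Fin (n + 1) → ℤˣ) :
    tau n * signedPerm π ε * (tau n)⁻¹ = signedPerm π fun j =>
      (if π j = Fin.last n then -1 else 1) * ε j * if j = Fin.last n then -1 else 1 := by
  rw [tau_inv, tau, signedPerm_mul, signedPerm_mul]
  simp only [one_mul, mul_one, Equiv.Perm.one_apply]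
  rfl

theorem tau_conj_posAt_last (π : Equiv.Perm (Fin (n + 1))) :
    tau n * signedPerm π (posAt (Fin.last n)) * (tau n)⁻¹ =
      signedPerm π (posAt (π.symm (Fin.last n))) := by
  rw [tau_conj_signedPerm]
  congr 1
  funext j
  simp only [posAt, Equiv.eq_symm_apply]
  split_ifs <;> rfl

theorem tau_conj_posAt_symm_last (π : Equiv.Perm (Fin (n + 1))) :
    tau n * signedPerm π (posAt (π.symm (Fin.last n))) * (tau n)⁻¹ =
      signedPerm π (posAt (Fin.last n)) := by
  rw [← tau_conj_posAt_last, tau_inv, ← mul_assoc, ← mul_assoc, tau_mul_self, one_mul, mul_assoc,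
    tau_mul_self, mul_one]

/-- Negating e_r interchanges the last two simple roots and fixes the others. -/
theorem tau_mem_simpleRoots {α : V n} (h : α ∈ simpleRoots n) : tau n α ∈ simpleRoots n := by
  rcases h with ⟨i, rfl⟩ | ⟨i, hi, rfl⟩
  · rw [map_sub, tau_e (Fin.castSucc_lt_last i).ne]
    by_cases hi : i.succ = Fin.last n
    · rw [hi, tau_e_last, sub_neg_eq_add]
      exact Or.inr ⟨i, hi, by rw [hi]⟩
    · rw [tau_e hi]
      exact Or.inl ⟨i, rfl⟩
  · rw [map_add, tau_e (Fin.castSucc_lt_last i).ne, hi, tau_e_last]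
    exact Or.inl ⟨i, by rw [hi, sub_eq_add_neg]⟩

theorem tau_mem_posRoots {α : V n} (h : α ∈ posRoots n) : tau n α ∈ posRoots n := by
  rcases h with ⟨i, j, hij, rfl⟩ | ⟨i, j, hij, rfl⟩ <;>
    have hi : i ≠ Fin.last n := (hij.trans_le (Fin.le_last j)).ne
  · rw [map_sub, tau_e hi]
    by_cases hj : j = Fin.last n
    · subst hj
      rw [tau_e_last, sub_neg_eq_add]
      exact add_mem_posRoots hi
    · rw [tau_e hj]
      exact sub_mem_posRoots hij
  · rw [map_add, tau_e hi]
    by_cases hj : j = Fin.last n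
    · subst hj
      rw [tau_e_last, ← sub_eq_add_neg]
      exact sub_mem_posRoots hij
    · rw [tau_e hj]
      exact add_mem_posRoots hij.ne

theorem RootLE.tau {ρ η : V n} (h : RootLE ρ η) : RootLE (tau n ρ) (tau n η) := by
  rw [RootLE, ← map_sub]
  have key : ∀ x ∈ AddSubmonoid.closure (simpleRoots n),
      TypeD.tau n x ∈ AddSubmonoid.closure (simpleRoots n) := by
    intro x hx
    induction hx using AddSubmonoid.closure_induction with
    | mem x hx => exact AddSubmonoid.subset_closure (tau_mem_simpleRoots hx)
    | zero => rw [map_zero]; exact zero_mem _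
    | add x y _ _ hx hy => rw [map_add]; exact add_mem hx hy
  exact key _ h

theorem tau_mem_nu {u : V n ≃ₗ[ℝ] V n} (k : ℕ) {β : V n}
    (h : β ∈ nu (tau n * u * (tau n)⁻¹) k) : tau n β ∈ nu u k := by
  rw [tau_inv] at h
  induction k generalizing β with
  | zero =>
    obtain ⟨⟨γ, hγ, rfl⟩, hp⟩ := h
    exact ⟨⟨tau n γ, tau_mem_posRoots hγ, (tau_tau _).symm⟩, tau_mem_posRoots hp⟩
  | succ k ih =>
    obtain ⟨⟨γ, ⟨hγ, β, hβ, hle⟩, rfl⟩, hp⟩ := h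
    exact ⟨⟨tau n γ, ⟨tau_mem_posRoots hγ, tau n β, ih hβ, hle.tau⟩, (tau_tau _).symm⟩,
      tau_mem_posRoots hp⟩

theorem IsRational.tau_conj {u : V n ≃ₗ[ℝ] V n} (h : IsRational u) :
    IsRational (tau n * u * (tau n)⁻¹) := by
  obtain ⟨K, hK⟩ := h
  refine ⟨K, fun k hk => Set.eq_empty_of_forall_notMem fun β hβ => ?_⟩
  have := tau_mem_nu k hβ
  rw [hK k hk] at this
  exact this

theorem tau_dotProduct (x y : V n) : tau n x ⬝ᵥ tau n y = x ⬝ᵥ y := by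
  refine sum_congr rfl fun i _ => ?_
  change ((if i = Fin.last n then (-1 : ℤˣ) else 1 : ℤˣ) : ℝ) * x i *
    (((if i = Fin.last n then (-1 : ℤˣ) else 1 : ℤˣ) : ℝ) * y i) = x i * y i
  split_ifs <;> simp

theorem tau_conj_reflection (α : V n) :
    tau n * reflection α * (tau n)⁻¹ = reflection (tau n α) := by
  rw [tau_inv]
  ext1 x
  change tau n (reflection α (tau n x)) = _
  have h : tau n x ⬝ᵥ α = x ⬝ᵥ tau n α := by rw [← tau_dotProduct, tau_tau]
  rw [reflection_apply, reflection_apply, map_sub, map_smul, tau_tau, tau_dotProduct, h]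

theorem leftMulGraph_adj_tau_conj {u v : V n ≃ₗ[ℝ] V n} (h : (leftMulGraph n).Adj u v) :
    (leftMulGraph n).Adj (tau n * u * (tau n)⁻¹) (tau n * v * (tau n)⁻¹) := by
  obtain ⟨α, hα, rfl⟩ := h
  refine ⟨tau n α, tau_mem_simpleRoots hα, ?_⟩
  rw [← tau_conj_reflection]
  group

/-! ### The vertices of the rationality graph -/

theorem prod_posAt (hodd : Odd (n + 1)) (m : Fin (n + 1)) : ∏ j, posAt m j = 1 := by
  have h : Even n := by
    rcases Nat.even_or_odd n with h | h
    · exact h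
    · exact absurd h.add_one (Nat.not_even_iff_odd.2 hodd)
  rw [← mul_prod_erase univ _ (mem_univ m),
    prod_congr rfl (g := fun _ => (-1 : ℤˣ)) fun j hj => by simp [posAt, ne_of_mem_erase hj]]
  simp [posAt, h]

theorem exists_eq_one_of_prod (hodd : Odd (n + 1)) {ε : Fin (n + 1) → ℤˣ}
    (h : ∏ j, ε j = 1) : ∃ j, ε j = 1 := by
  by_contra! hne
  rw [prod_congr rfl fun j _ => (Int.units_eq_one_or (ε j)).resolve_left (hne j)] at h
  simp [hodd.neg_one_pow] at h

theorem tau_conj_mem_dSet {u : V n ≃ₗ[ℝ] V n} (h : u ∈ cSet n) :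
    tau n * u * (tau n)⁻¹ ∈ dSet n := by
  obtain ⟨π, hπ, rfl⟩ := mem_cSet.1 h
  exact mem_dSet.2 ⟨π, hπ, tau_conj_posAt_last π⟩

theorem tau_conj_mem_cSet {u : V n ≃ₗ[ℝ] V n} (h : u ∈ dSet n) :
    tau n * u * (tau n)⁻¹ ∈ cSet n := by
  obtain ⟨π, hπ, rfl⟩ := mem_dSet.1 h
  exact mem_cSet.2 ⟨π, hπ, tau_conj_posAt_symm_last π⟩

theorem tau_conj_tau_conj (u : V n ≃ₗ[ℝ] V n) :
    tau n * (tau n * u * (tau n)⁻¹) * (tau n)⁻¹ = u := by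
  rw [tau_inv, ← mul_assoc, ← mul_assoc, tau_mul_self, one_mul, mul_assoc, tau_mul_self, mul_one]

theorem isRational_of_mem_cSet {u : V n ≃ₗ[ℝ] V n} (h : u ∈ cSet n) : IsRational u := by
  obtain ⟨π, hπ, rfl⟩ := mem_cSet.1 h
  exact isRational_of_le hπ

theorem isRational_of_mem_dSet {u : V n ≃ₗ[ℝ] V n} (h : u ∈ dSet n) : IsRational u := by
  rw [← tau_conj_tau_conj u]
  exact (isRational_of_mem_cSet (tau_conj_mem_cSet h)).tau_conj

theorem cSet_subset_verts (hodd : Odd (n + 1)) : cSet n ⊆ (rationalityGraph n).verts := by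
  intro u hu
  refine ⟨?_, isRational_of_mem_cSet hu⟩
  obtain ⟨π, -, rfl⟩ := mem_cSet.1 hu
  exact ⟨π, _, prod_posAt hodd _, rfl⟩

theorem dSet_subset_verts (hodd : Odd (n + 1)) : dSet n ⊆ (rationalityGraph n).verts := by
  intro u hu
  refine ⟨?_, isRational_of_mem_dSet hu⟩
  obtain ⟨π, -, rfl⟩ := mem_dSet.1 hu
  exact ⟨π, _, prod_posAt hodd _, rfl⟩

theorem verts_subset_union (hodd : Odd (n + 1)) :
    (rationalityGraph n).verts ⊆ cSet n ∪ dSet n := by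
  rintro _ ⟨⟨π, ε, hε, rfl⟩, hr⟩
  obtain ⟨m, rfl, rfl | hm⟩ := hr.exists_eq_posAt (exists_eq_one_of_prod hodd hε)
  · exact Or.inl (mem_cSet.2 ⟨π, fun j hj => hr.le_apply hj, rfl⟩)
  · obtain rfl : m = π.symm (Fin.last n) := by rw [← hm, Equiv.symm_apply_apply]
    have hr' := hr.tau_conj
    rw [tau_conj_posAt_symm_last] at hr'
    exact Or.inr (mem_dSet.2 ⟨π, fun j hj => hr'.le_apply hj, rfl⟩)

theorem posAt_injective : Function.Injective (posAt (n := n)) := by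
  intro a b h
  by_contra hne
  have := congrFun h a
  simp only [posAt, if_true, if_neg hne] at this
  exact absurd this (by decide)

theorem w0_eq : w0 n = signedPerm 1 (posAt (Fin.last n)) := rfl

theorem cSet_inter_dSet : cSet n ∩ dSet n = {w0 n} := by
  refine Set.Subset.antisymm ?_ ?_
  · rintro u ⟨hc, hd⟩
    obtain ⟨π, hπ, rfl⟩ := mem_cSet.1 hc
    obtain ⟨π', -, h⟩ := mem_dSet.1 hd
    obtain ⟨rfl, h⟩ := signedPerm_injective h
    have hlast : π (Fin.last n) = Fin.last n := ((Equiv.eq_symm_apply π).1 (posAt_injective h))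
    have key : ∀ j, j ≤ π j := fun j => by
      by_cases hj : j = Fin.last n
      · rw [hj, hlast]
      · exact hπ j hj
    have : π = 1 := by
      ext j
      by_contra hne
      -- A permutation preserves the sum of all indices, so one that decreases none of them cannot
      -- increase any.
      have hsum := sum_lt_sum (s := univ) (f := fun j : Fin (n + 1) => (j : ℕ))
        (g := fun j => (π j : ℕ)) (fun i _ => key i)
        ⟨j, mem_univ j, lt_of_le_of_ne (key j) fun h => hne h.symm⟩
      rw [Equiv.sum_comp π fun j : Fin (n + 1) => (j : ℕ)] at hsum
      exact lt_irrefl _ hsum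
    rw [this, ← w0_eq]
    rfl
  · rintro _ rfl
    exact ⟨Or.inl rfl, Or.inl rfl⟩

/-! ### The edges of the rationality graph -/

theorem dotProduct_e (x : V n) (a : Fin (n + 1)) : x ⬝ᵥ e a = x a := by
  simp [e]

theorem reflection_sub {a b : Fin (n + 1)} (h : a ≠ b) :
    reflection (e a - e b) = signedPerm (Equiv.swap a b) fun _ => 1 := by
  ext x i
  have h1 : (e a - e b : V n) ⬝ᵥ (e a - e b) = 2 := by
    simp only [dotProduct_sub, dotProduct_e]
    simp [e, h, h.symm]
    norm_num
  rw [reflection_apply, h1, dotProduct_sub, dotProduct_e, dotProduct_e,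
    mul_div_cancel_left₀ _ two_ne_zero]
  change x i - (x a - x b) * (e a i - e b i) = (((1 : ℤˣ) : ℤ) : ℝ) * x (Equiv.swap a b i)
  rcases eq_or_ne i a with rfl | hia
  · simp [e, h]
  · rcases eq_or_ne i b with rfl | hib
    · simp [e, hia]
    · simp [e, hia, hib, Equiv.swap_apply_of_ne_of_ne]

theorem reflection_add {a b : Fin (n + 1)} (h : a ≠ b) :
    reflection (e a + e b) =
      signedPerm (Equiv.swap a b) fun j => if j = a ∨ j = b then -1 else 1 := by
  ext x i
  have h1 : (e a + e b : V n) ⬝ᵥ (e a + e b) = 2 := by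
    simp only [dotProduct_add, dotProduct_e]
    simp [e, h, h.symm]
    norm_num
  rw [reflection_apply, h1, dotProduct_add, dotProduct_e, dotProduct_e,
    mul_div_cancel_left₀ _ two_ne_zero]
  change x i - (x a + x b) * (e a i + e b i) =
    (((if Equiv.swap a b i = a ∨ Equiv.swap a b i = b then -1 else 1 : ℤˣ) : ℤ) : ℝ) *
      x (Equiv.swap a b i)
  rcases eq_or_ne i a with rfl | hia
  · simp [e, h]
  · rcases eq_or_ne i b with rfl | hib
    · simp [e, hia]
    · simp [e, hia, hib, Equiv.swap_apply_of_ne_of_ne]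

/-- Left multiplication by e_i - e_{i+1} leaves the sign vector alone, so the positive index of `v`
is r. For e_{r-1} + e_r, the sign at r changes only if π r is r - 1 or r: if π r = r then `u` is in
both families; if π r = r - 1, the swap makes π' fix r; otherwise r stays positive for `v`. -/
theorem mem_of_adj {u v : V n ≃ₗ[ℝ] V n} (hu : u ∈ cSet n) (hv : v ∈ dSet n)
    (h : (leftMulGraph n).Adj u v) : u ∈ dSet n ∨ v ∈ cSet n := by
  obtain ⟨π, hπ, rfl⟩ := mem_cSet.1 hu
  obtain ⟨π', hπ', rfl⟩ := mem_dSet.1 hv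
  suffices π (Fin.last n) = Fin.last n ∨ π'.symm (Fin.last n) = Fin.last n by
    refine this.imp (fun h => mem_dSet.2 ⟨π, hπ, ?_⟩) fun h => mem_cSet.2 ⟨π', hπ', by rw [h]⟩
    rw [(Equiv.symm_apply_eq π).2 h.symm]
  obtain ⟨α, ⟨i, rfl⟩ | ⟨i, hi, rfl⟩, h⟩ := h
  · rw [reflection_sub (Fin.castSucc_lt_succ).ne, signedPerm_mul] at h
    obtain ⟨-, h⟩ := signedPerm_injective h
    simp only [one_mul] at h
    exact Or.inr (posAt_injective h)
  · rw [reflection_add (Fin.castSucc_lt_succ).ne, signedPerm_mul] at h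
    obtain ⟨rfl, h⟩ := signedPerm_injective h
    by_cases hl : π (Fin.last n) = Fin.last n
    · exact Or.inl hl
    right
    by_cases ha : π (Fin.last n) = i.castSucc
    · rw [Equiv.symm_apply_eq, Equiv.Perm.mul_apply, ha, Equiv.swap_apply_left, hi]
    · have h1 := congrFun h (Fin.last n)
      rw [hi, if_neg (by tauto)] at h1
      by_contra hne
      rw [hi] at hne
      simp only [posAt, if_true, if_neg (Ne.symm hne)] at h1
      exact absurd h1 (by decide)

theorem rationalityGraph_eq_sup (hodd : Odd (n + 1)) :
    rationalityGraph n = cHalf n ⊔ dHalf n := by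
  have hverts := verts_subset_union hodd
  refine SimpleGraph.Subgraph.ext ?_ ?_
  · exact Set.Subset.antisymm hverts
      (Set.union_subset (cSet_subset_verts hodd) (dSet_subset_verts hodd))
  · funext u v
    refine propext ⟨fun h => ?_, fun h => ?_⟩
    · have hadj : (leftMulGraph n).Adj u v := h.adj_sub
      have hc : u ∈ cSet n → v ∈ cSet n → (cHalf n ⊔ dHalf n).Adj u v := fun hu hv =>
        Or.inl ⟨hu, hv, h⟩
      have hd : u ∈ dSet n → v ∈ dSet n → (cHalf n ⊔ dHalf n).Adj u v := fun hu hv =>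
        Or.inr ⟨hu, hv, h⟩
      rcases hverts h.fst_mem with hu | hu <;> rcases hverts h.snd_mem with hv | hv
      · exact hc hu hv
      · exact (mem_of_adj hu hv hadj).elim (hd · hv) (hc hu ·)
      · exact (mem_of_adj hv hu hadj.symm).elim (hd hu ·) (hc · hv)
      · exact hd hu hv
    · rcases h with h | h <;> exact h.2.2

theorem rationalityGraph_adj_tau_conj {u v : V n ≃ₗ[ℝ] V n}
    (hu : tau n * u * (tau n)⁻¹ ∈ (rationalityGraph n).verts)
    (hv : tau n * v * (tau n)⁻¹ ∈ (rationalityGraph n).verts)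
    (h : (rationalityGraph n).Adj u v) :
    (rationalityGraph n).Adj (tau n * u * (tau n)⁻¹) (tau n * v * (tau n)⁻¹) :=
  ⟨hu, hv, leftMulGraph_adj_tau_conj h.adj_sub⟩

/-- Conjugation by the diagram automorphism, as an isomorphism between the two halves. -/
def halfIso (hodd : Odd (n + 1)) : (cHalf n).coe ≃g (dHalf n).coe where
  toFun u := ⟨tau n * u * (tau n)⁻¹, tau_conj_mem_dSet u.2⟩
  invFun u := ⟨tau n * u * (tau n)⁻¹, tau_conj_mem_cSet u.2⟩
  left_inv u := Subtype.ext (tau_conj_tau_conj _)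
  right_inv u := Subtype.ext (tau_conj_tau_conj _)
  map_rel_iff' := by
    rintro ⟨u, hu⟩ ⟨v, hv⟩
    constructor
    · rintro ⟨hu', hv', h⟩
      refine ⟨hu, hv, ?_⟩
      have := rationalityGraph_adj_tau_conj
        (cSet_subset_verts hodd (tau_conj_mem_cSet hu'))
        (cSet_subset_verts hodd (tau_conj_mem_cSet hv')) h
      simpa only [Equiv.coe_fn_mk, tau_conj_tau_conj] using this
    · rintro ⟨-, -, h⟩
      exact ⟨tau_conj_mem_dSet hu, tau_conj_mem_dSet hv, rationalityGraph_adj_tau_conj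
        (dSet_subset_verts hodd (tau_conj_mem_dSet hu))
        (dSet_subset_verts hodd (tau_conj_mem_dSet hv)) h⟩

end TypeD

/-- Here `r = n + 1`. The vertex part of the third conjunct says that the rational elements of
`W(D_r)` are exactly `w_0` and the elements `c_I`, `d_I`. -/
theorem corollary8p3 (n : ℕ) (hr : 5 ≤ n + 1) (hodd : Odd (n + 1)) :
    TypeD.cSet n ⊆ (TypeD.rationalityGraph n).verts ∧
    TypeD.dSet n ⊆ (TypeD.rationalityGraph n).verts ∧
    TypeD.rationalityGraph n = TypeD.cHalf n ⊔ TypeD.dHalf n ∧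
    (TypeD.cHalf n).verts ∩ (TypeD.dHalf n).verts = {TypeD.w0 n} ∧
    ∃ φ : (TypeD.cHalf n).coe ≃g (TypeD.dHalf n).coe,
      ∀ u : (TypeD.cHalf n).verts,
        (φ u : TypeD.V n ≃ₗ[ℝ] TypeD.V n) = TypeD.tau n * (u : TypeD.V n ≃ₗ[ℝ] TypeD.V n) * (TypeD.tau n)⁻¹ := by
  exact ⟨TypeD.cSet_subset_verts hodd, TypeD.dSet_subset_verts hodd,
    TypeD.rationalityGraph_eq_sup hodd, TypeD.cSet_inter_dSet, TypeD.halfIso hodd, fun _ => rfl⟩
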